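/- Let $\mathcal H$ be a real separable Hilbert space with inner product $\langle\cdot,\cdot\rangle$ and norm $|\cdot|$, and let $\mathcal N\subset\mathcal H$ be a nuclear space, densely and continuously embedded in $\mathcal H$, which is the projective limit $\mathcal N=\bigcap_{p\ge 0}\mathcal H_p$ of real separable Hilbert spaces $\mathcal H_p$ with $\mathcal H_0=\mathcal H$, $\mathcal H_{p+1}\subset\mathcal H_p$, $|\cdot|_p\le|\cdot|_{p+1}$ on $\mathcal H_{p+1}$, and Hilbert–Schmidt inclusions $\mathcal H_{p+1}\subset\mathcal H_p$. Let $\mathcal N_{\mathbb C}=\{\varphi_1+i\varphi_2:\varphi_1,\varphi_2\in\mathcal N\}$ be the complexification of $\mathcal N$, with $|\varphi_1+i\varphi_2|^2=|\varphi_1|^2+|\varphi_2|^2$, and extend $\langle\cdot,\cdot\rangle$ complex-bilinearly. For $0<\beta\le 1$ let $$\mathrm E_\beta(z)=\sum_{n=0}^\infty\frac{z^n}{\Gamma(\beta n+1)},\qquad z\in\mathbb C,$$ be the Mittag-Leffler function. For $\eta\in\mathcal H$, $\varphi\in\mathcal N_{\mathbb C}$ and $x\in\mathbb R$ let $$z(x,\eta,\varphi)=\tfrac12x^2\langle\eta,\eta\rangle+\tfrac12\langle\varphi,\varphi\rangle+x\langle\eta,\varphi\rangle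 .$$ Then for every $0<\beta\le1$, every $\eta\in\mathcal H$ with $\eta\neq0$ and every $0<M<\infty$ there is a constant $C<\infty$ (which may depend on $\beta$, $\eta$ and $M$, but not on $\varphi$) such that $$\int_{\mathbb R}\bigl|\mathrm E_\beta(-z(x,\eta,\varphi))\bigr|\,dx\le C\qquad\text{for all }\varphi\in\mathcal N_{\mathbb C}\text{ with }|\varphi|<M .$$ -/

import Mathlib

open MeasureTheory

noncomputable section

/-- The Mittag-Leffler function `E_β(z) = ∑ zⁿ / Γ(β n + 1)`. -/
def mittagLeffler (β : ℝ) (z : ℂ) : ℂ :=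
  ∑' n : ℕ, z ^ n / Complex.Gamma ((β : ℂ) * (n : ℂ) + 1)

/-- A bounded operator between real Hilbert spaces is Hilbert-Schmidt if `∑ ‖T eᵢ‖² < ∞` for an
orthonormal (Hilbert) basis `(eᵢ)` of the source. -/
def IsHilbertSchmidtOp {E F : Type*} [NormedAddCommGroup E] [InnerProductSpace ℝ E]
    [CompleteSpace E] [NormedAddCommGroup F] [InnerProductSpace ℝ F] (T : E →L[ℝ] F) : Prop :=
  ∃ (s : Set E) (b : HilbertBasis s ℝ E), Summable fun i : s => ‖T (b i)‖ ^ 2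

/-- The data that make `N ⊂ H` part of a nuclear triple `N ⊂ H ⊂ N'`: real separable Hilbert spaces
`K p` with `K 0 = H` and norm-decreasing Hilbert-Schmidt inclusions `K (p + 1) ⊂ K p`, whose
projective limit is `N`, with `N` dense in `H`. -/
structure NuclearTriple (N H : Type*) (K : ℕ → Type*)
    [AddCommGroup N] [Module ℝ N] [TopologicalSpace N]
    [NormedAddCommGroup H] [InnerProductSpace ℝ H] [CompleteSpace H]
    [TopologicalSpace.SeparableSpace H]
    [∀ p, NormedAddCommGroup (K p)] [∀ p, InnerProductSpace ℝ (K p)] [∀ p, CompleteSpace (K p)]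
    [∀ p, TopologicalSpace.SeparableSpace (K p)] where
  /-- the identification `K 0 = H` -/
  zeroEquiv : K 0 ≃ₗᵢ[ℝ] H
  /-- the inclusion `K (p + 1) ⊂ K p` -/
  incl : ∀ p, K (p + 1) →L[ℝ] K p
  incl_injective : ∀ p, Function.Injective (incl p)
  norm_incl_le : ∀ p f, ‖incl p f‖ ≤ ‖f‖
  incl_hilbertSchmidt : ∀ p, IsHilbertSchmidtOp (incl p)
  /-- the inclusion `N ⊂ K p` -/
  proj : ∀ p, N →ₗ[ℝ] K p
  incl_proj : ∀ p φ, incl p (proj (p + 1) φ) = proj p φ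
  /-- `N` is the intersection of the `K p` -/
  exists_unique_lift : ∀ f : ∀ p, K p, (∀ p, incl p (f (p + 1)) = f p) →
    ∃! φ : N, ∀ p, proj p φ = f p
  /-- the topology of `N` is the coarsest one for which all inclusions `N ⊂ K p` are continuous -/
  topology_eq : (inferInstance : TopologicalSpace N) =
    ⨅ p, TopologicalSpace.induced (proj p) inferInstance
  dense_range : DenseRange fun φ : N => zeroEquiv (proj 0 φ)

namespace NuclearTriple

variable {N H : Type*} {K : ℕ → Type*}
    [AddCommGroup N] [Module ℝ N] [TopologicalSpace N]
    [NormedAddCommGroup H] [InnerProductSpace ℝ H] [CompleteSpace H]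
    [TopologicalSpace.SeparableSpace H]
    [∀ p, NormedAddCommGroup (K p)] [∀ p, InnerProductSpace ℝ (K p)] [∀ p, CompleteSpace (K p)]
    [∀ p, TopologicalSpace.SeparableSpace (K p)]

/-- The inclusion `N ⊂ H`. -/
def toH (T : NuclearTriple N H K) : N →ₗ[ℝ] H :=
  T.zeroEquiv.toLinearEquiv.toLinearMap ∘ₗ T.proj 0

end NuclearTriple

/-- The complexification of a real vector space: pairs `[f₁, f₂]`, thought of as `f₁ + i f₂`. -/
@[ext]
structure Complexified (E : Type*) where
  re : E
  im : E

namespace Complexified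

section Algebra

variable {E F : Type*} [AddCommGroup E] [AddCommGroup F]

instance : Zero (Complexified E) := ⟨⟨0, 0⟩⟩
instance : Add (Complexified E) := ⟨fun f g => ⟨f.re + g.re, f.im + g.im⟩⟩
instance : Neg (Complexified E) := ⟨fun f => ⟨-f.re, -f.im⟩⟩

@[simp] theorem zero_re : (0 : Complexified E).re = 0 := rfl
@[simp] theorem zero_im : (0 : Complexified E).im = 0 := rfl
@[simp] theorem add_re (f g : Complexified E) : (f + g).re = f.re + g.re := rfl
@[simp] theorem add_im (f g : Complexified E) : (f + g).im = f.im + g.im := rfl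
@[simp] theorem neg_re (f : Complexified E) : (-f).re = -f.re := rfl
@[simp] theorem neg_im (f : Complexified E) : (-f).im = -f.im := rfl

variable [Module ℝ E] [Module ℝ F]

instance : SMul ℂ (Complexified E) :=
  ⟨fun c f => ⟨c.re • f.re - c.im • f.im, c.re • f.im + c.im • f.re⟩⟩

@[simp] theorem smul_re (c : ℂ) (f : Complexified E) :
    (c • f).re = c.re • f.re - c.im • f.im := rfl
@[simp] theorem smul_im (c : ℂ) (f : Complexified E) :
    (c • f).im = c.re • f.im + c.im • f.re := rfl

instance : AddCommGroup (Complexified E) where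
  add_assoc f g h := by ext <;> simp [add_assoc]
  zero_add f := by ext <;> simp
  add_zero f := by ext <;> simp
  add_comm f g := by ext <;> simp [add_comm]
  neg_add_cancel f := by ext <;> simp
  nsmul := nsmulRec
  zsmul := zsmulRec

instance : Module ℂ (Complexified E) where
  one_smul f := by ext <;> simp
  mul_smul c d f := by ext <;> simp <;> module
  smul_zero c := by ext <;> simp
  smul_add c f g := by ext <;> simp <;> module
  add_smul c d f := by ext <;> simp <;> module
  zero_smul f := by ext <;> simp

/-- The real vector space `E` as a subset of its complexification. -/
def ofReal (f : E) : Complexified E := ⟨f, 0⟩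

/-- The complex linear extension of a real linear map. -/
def map (L : E →ₗ[ℝ] F) : Complexified E →ₗ[ℂ] Complexified F where
  toFun f := ⟨L f.re, L f.im⟩
  map_add' f g := by ext <;> simp
  map_smul' c f := by ext <;> simp

end Algebra

section Hilbert

variable {H : Type*} [NormedAddCommGroup H] [InnerProductSpace ℝ H]

/-- The complex bilinear (not sesquilinear) extension of the real inner product. -/
def pairing (f g : Complexified H) : ℂ :=
  ((inner ℝ f.re g.re - inner ℝ f.im g.im : ℝ) : ℂ) +
    Complex.I * ((inner ℝ f.re g.im + inner ℝ f.im g.re : ℝ) : ℂ)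

/-- The Hilbert space norm of the complexification, `|f₁ + i f₂|² = |f₁|² + |f₂|²`. -/
def hnorm (f : Complexified H) : ℝ := Real.sqrt (‖f.re‖ ^ 2 + ‖f.im‖ ^ 2)

end Hilbert

end Complexified

/-- `z(x, η, φ) = ½ x² ⟨η, η⟩ + ½ ⟨φ, φ⟩ + x ⟨η, φ⟩`. -/
def donskerArg {H : Type*} [NormedAddCommGroup H] [InnerProductSpace ℝ H]
    (x : ℝ) (η : H) (φ : Complexified H) : ℂ :=
  1 / 2 * (x : ℂ) ^ 2 *
      Complexified.pairing (Complexified.ofReal η) (Complexified.ofReal η) +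
    1 / 2 * Complexified.pairing φ φ +
    (x : ℂ) * Complexified.pairing (Complexified.ofReal η) φ

end

/-! Everything rests on the decay `norm_mittagLeffler_neg_le` in the right half-plane of `z`,
obtained without contour integrals. By Euler's limit `risingCoeff (1 + s) n / n ^ s` tends to `1 /
Γ(s + 1)`, so `E_β(-z)` is the limit of the `n`-th coefficient `D_n` of `(1 - X)^(β-1) / (ε + (1 -
X)^β)` at `ε = z / n^β`. For `0 < β ≤ 1` all coefficients of `(1 - X)^β` past the constant one are
nonpositive. Hence the expansion of `(ε + (1 - X)^β)⁻¹` is dominated by the one at `Re ε`, whose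
coefficients are nonnegative. For real `ε > 0` the `D_n` decrease, and the convolution equation they
satisfy then gives `D_n ≤ (1 + ε * risingCoeff (1 + β) n)⁻¹`. Since `Re z` grows like `x²`,
uniformly in `|φ| < M`, this decay is integrable at infinity; for bounded `x` the continuity of
`E_β` on a disc suffices. -/

open Filter Topology PowerSeries

/-! ### Binomial coefficients -/

/-- The Taylor coefficients `a (a + 1) ⋯ (a + n - 1) / n!` of `(1 - X) ^ (-a)`. -/
noncomputable def risingCoeff (a : ℝ) (n : ℕ) : ℝ :=
  ∏ i ∈ Finset.range n, (a + i) / (i + 1)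

@[simp] theorem risingCoeff_zero_right (a : ℝ) : risingCoeff a 0 = 1 := by simp [risingCoeff]

theorem risingCoeff_succ (a : ℝ) (n : ℕ) :
    risingCoeff a (n + 1) = risingCoeff a n * ((a + n) / (n + 1)) := by
  rw [risingCoeff, Finset.prod_range_succ, risingCoeff]

theorem risingCoeff_nonneg {a : ℝ} (ha : 0 ≤ a) (n : ℕ) : 0 ≤ risingCoeff a n :=
  Finset.prod_nonneg fun i _ => by positivity

theorem risingCoeff_one (n : ℕ) : risingCoeff 1 n = 1 :=
  Finset.prod_eq_one fun i _ => by rw [add_comm]; exact div_self (by positivity)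

theorem risingCoeff_zero_left_succ (n : ℕ) : risingCoeff 0 (n + 1) = 0 :=
  Finset.prod_eq_zero (Finset.mem_range.2 n.succ_pos) (by simp)

/-- Only the factor `i = 0` of the product is nonpositive, because `b ≤ 1`. This sign drives the
domination argument. -/
theorem risingCoeff_neg_succ_nonpos {b : ℝ} (hb0 : 0 ≤ b) (hb1 : b ≤ 1) (n : ℕ) :
    risingCoeff (-b) (n + 1) ≤ 0 := by
  induction n with
  | zero => simpa [risingCoeff] using hb0
  | succ n ih =>
    rw [risingCoeff_succ]
    refine mul_nonpos_of_nonpos_of_nonneg ih (div_nonneg ?_ (by positivity))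
    push_cast
    linarith [n.cast_nonneg (α := ℝ)]

theorem choose_neg_eq_risingCoeff (a : ℝ) (n : ℕ) :
    Ring.choose (-a) n = (-1) ^ n * risingCoeff a n := by
  have h : (n.factorial : ℝ) * risingCoeff a n = (ascPochhammer ℕ n).smeval a := by
    rw [Polynomial.ascPochhammer_smeval_eq_eval]
    induction n with
    | zero => simp
    | succ n ih =>
      rw [ascPochhammer_succ_eval, ← ih, risingCoeff_succ, Nat.factorial_succ]
      push_cast
      field_simp
  have h2 := Ring.factorial_nsmul_multichoose_eq_ascPochhammer a n
  rw [← h, nsmul_eq_mul] at h2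
  have h3 : Ring.multichoose a n = risingCoeff a n :=
    mul_left_cancel₀ (by positivity) h2
  rw [Ring.choose_neg, ← h3, Ring.multichoose_eq]
  simp [Units.smul_def, Int.negOnePow_def]

/-- Chu–Vandermonde, up to the sign `(-1)^n`. -/
theorem risingCoeff_add (a b : ℝ) (n : ℕ) :
    risingCoeff (a + b) n =
      ∑ p ∈ Finset.HasAntidiagonal.antidiagonal n, risingCoeff a p.1 * risingCoeff b p.2 := by
  have h := Ring.add_choose_eq (r := -a) (s := -b) n (Commute.all _ _)
  rw [← neg_add, choose_neg_eq_risingCoeff] at h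
  refine mul_left_cancel₀ (pow_ne_zero n (by norm_num : (-1 : ℝ) ≠ 0)) (h.trans ?_)
  rw [Finset.mul_sum]
  refine Finset.sum_congr rfl fun p hp => ?_
  rw [choose_neg_eq_risingCoeff, choose_neg_eq_risingCoeff, ← Finset.HasAntidiagonal.mem_antidiagonal.1 hp, pow_add]
  ring

theorem risingCoeff_one_add_le {s : ℝ} (hs : 0 ≤ s) (n : ℕ) :
    risingCoeff (1 + s) n ≤ (1 + s) ^ n := by
  refine (Finset.prod_le_prod (fun i _ => by positivity) fun i _ => ?_).trans
    (Finset.prod_const (1 + s) |>.trans (by simp)).le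
  rw [div_le_iff₀ (by positivity)]
  nlinarith [mul_nonneg hs (i.cast_nonneg (α := ℝ))]

/-! ### Euler's limit and bounds for `1 / Γ` -/

/-- The ratio of consecutive terms is at most one because `log (1 + 1/n) ≥ 1/(n + 1)`. Any fixed
term thus bounds all later ones and the limit, which supplies dominated convergence. -/
theorem risingCoeff_one_add_div_rpow_antitone {s : ℝ} (hs : 0 ≤ s) {m n : ℕ} (hm : 0 < m)
    (hmn : m ≤ n) :
    risingCoeff (1 + s) n / (n : ℝ) ^ s ≤ risingCoeff (1 + s) m / (m : ℝ) ^ s := by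
  induction n, hmn using Nat.le_induction with
  | base => rfl
  | succ n hn ih =>
    refine le_trans ?_ ih
    have hn0 : (0 : ℝ) < n := by exact_mod_cast hm.trans_le hn
    have key : (1 + s + n) / (n + 1) ≤ ((n + 1 : ℝ) / n) ^ s := by
      have h1 : (1 + s + n) / (n + 1) = s / (n + 1 : ℝ) + 1 := by field_simp; ring
      rw [h1, Real.rpow_def_of_pos (by positivity)]
      refine (Real.add_one_le_exp _).trans (Real.exp_le_exp.2 ?_)
      have h2 := Real.one_sub_inv_le_log_of_pos (show (0 : ℝ) < (n + 1) / n by positivity)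
      have h3 : 1 - ((n + 1 : ℝ) / n)⁻¹ = 1 / (n + 1) := by field_simp; ring
      rw [h3] at h2
      calc s / (n + 1 : ℝ) = 1 / (n + 1) * s := by ring
        _ ≤ _ := mul_le_mul_of_nonneg_right h2 hs
    rw [Real.div_rpow (by positivity) hn0.le] at key
    rw [risingCoeff_succ]
    push_cast
    have h4 : (0 : ℝ) < (n : ℝ) ^ s := by positivity
    have h5 : (0 : ℝ) < (n + 1 : ℝ) ^ s := by positivity
    rw [div_le_div_iff₀ h5 h4]
    rw [le_div_iff₀ h4] at key
    calc _ = risingCoeff (1 + s) n * ((1 + s + n) / (n + 1) * n ^ s) := by ring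
      _ ≤ _ := mul_le_mul_of_nonneg_left key (risingCoeff_nonneg (by positivity) n)

theorem risingCoeff_one_add_eq (s : ℝ) (n : ℕ) :
    (n.factorial : ℝ) * risingCoeff (1 + s) n = ∏ j ∈ Finset.range n, (s + (j + 1 : ℕ)) := by
  induction n with
  | zero => simp
  | succ n ih =>
    rw [Finset.prod_range_succ, ← ih, risingCoeff_succ, Nat.factorial_succ]
    push_cast
    field_simp
    ring

/-- Euler's limit formula in terms of binomial coefficients. -/
theorem tendsto_risingCoeff_one_add_div_rpow {s : ℝ} (hs : 0 ≤ s) :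
    Tendsto (fun n : ℕ => risingCoeff (1 + s) n / (n : ℝ) ^ s) atTop
      (𝓝 (Real.Gamma (s + 1))⁻¹) := by
  -- At `s = 0` the identity `s Γ(s) = Γ(s + 1)` is not available.
  rcases hs.eq_or_lt with rfl | hs
  · simp [risingCoeff_one]
  have h := ((Real.GammaSeq_tendsto_Gamma s).const_mul s).inv₀
    (mul_pos hs (Real.Gamma_pos_of_pos hs)).ne'
  rw [← Real.Gamma_add_one hs.ne'] at h
  refine h.congr' ?_
  filter_upwards [eventually_gt_atTop 0] with n hn
  have hf : (n.factorial : ℝ) ≠ 0 := by positivity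
  have hn' : (n : ℝ) ^ s ≠ 0 := by positivity
  rw [Real.GammaSeq, Finset.prod_range_succ', ← risingCoeff_one_add_eq]
  simp only [Nat.cast_zero, add_zero]
  field_simp

theorem inv_Gamma_le {s : ℝ} (hs : 0 ≤ s) {L : ℕ} (hL : 0 < L) :
    (Real.Gamma (s + 1))⁻¹ ≤ (1 + s) ^ L / (L : ℝ) ^ s := by
  refine (le_of_tendsto (tendsto_risingCoeff_one_add_div_rpow hs)
    ((eventually_ge_atTop L).mono fun n hn =>
      risingCoeff_one_add_div_rpow_antitone hs hL hn)).trans ?_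
  gcongr
  exact risingCoeff_one_add_le hs L

/-! ### Convergence and continuity of the Mittag-Leffler series -/

theorem summable_one_add_mul_pow_mul_pow (β : ℝ) (L : ℕ) {q : ℝ} (hq0 : 0 ≤ q) (hq : q < 1) :
    Summable fun k : ℕ => (1 + k * β) ^ L * q ^ k := by
  have : ∀ k : ℕ, (1 + k * β) ^ L * q ^ k =
      ∑ j ∈ Finset.range (L + 1), (β ^ (L - j) * (L.choose j)) * ((k : ℝ) ^ (L - j) * q ^ k) := by
    intro k
    rw [add_pow, Finset.sum_mul]
    refine Finset.sum_congr rfl fun j _ => ?_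
    rw [mul_pow]; ring
  simp_rw [this]
  refine summable_sum fun j _ => Summable.mul_left _ ?_
  exact summable_pow_mul_geometric_of_norm_lt_one (R := ℝ) (L - j)
    (by rwa [Real.norm_of_nonneg hq0])

/-- For every radius there is a level from which on `R ^ k / L ^ (kβ)` decays geometrically. -/
theorem exists_rpow_ge {β : ℝ} (hβ : 0 < β) (R : ℝ) : ∃ L : ℕ, 0 < L ∧ 2 * R ≤ (L : ℝ) ^ β := by
  have h : Tendsto (fun n : ℕ => (n : ℝ) ^ β) atTop atTop :=
    (tendsto_rpow_atTop hβ).comp tendsto_natCast_atTop_atTop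
  obtain ⟨L, h1, h2⟩ := ((h.eventually_ge_atTop (2 * R)).and (eventually_gt_atTop 0)).exists
  exact ⟨L, h2, h1⟩

theorem pow_mul_div_rpow_le {β : ℝ} (hβ : 0 < β) {r R : ℝ} (hr : 0 ≤ r) (hrR : r ≤ R) {L : ℕ}
    (hL : 0 < L) (hRL : 2 * R ≤ (L : ℝ) ^ β) (k : ℕ) :
    r ^ k * ((1 + k * β) ^ L / (L : ℝ) ^ (k * β)) ≤ (1 + k * β) ^ L * (1 / 2 : ℝ) ^ k := by
  have hL' : (0 : ℝ) < (L : ℝ) ^ β := by positivity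
  have h1 : (L : ℝ) ^ (k * β) = ((L : ℝ) ^ β) ^ k := by
    rw [mul_comm, Real.rpow_mul_natCast (by positivity)]
  rw [h1]
  calc _ = (1 + k * β) ^ L * (r / (L : ℝ) ^ β) ^ k := by rw [div_pow]; ring
    _ ≤ _ := by
      have h2 : r / (L : ℝ) ^ β ≤ 1 / 2 := by
        rw [div_le_iff₀ hL']
        linarith
      gcongr

theorem complex_Gamma_mul_add_one (β : ℝ) (k : ℕ) :
    Complex.Gamma ((β : ℂ) * (k : ℂ) + 1) = (Real.Gamma (k * β + 1) : ℂ) := by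
  rw [← Complex.Gamma_ofReal]
  push_cast
  ring_nf

theorem norm_mittagLeffler_term_le {β : ℝ} (hβ : 0 < β) {R : ℝ} {z : ℂ} (hz : ‖z‖ ≤ R) {L : ℕ}
    (hL : 0 < L) (hRL : 2 * R ≤ (L : ℝ) ^ β) (k : ℕ) :
    ‖z ^ k / Complex.Gamma ((β : ℂ) * (k : ℂ) + 1)‖ ≤ (1 + k * β) ^ L * (1 / 2 : ℝ) ^ k := by
  have hs : (0 : ℝ) ≤ k * β := by positivity
  rw [complex_Gamma_mul_add_one, norm_div, norm_pow, Complex.norm_real, div_eq_mul_inv,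
    Real.norm_of_nonneg (Real.Gamma_pos_of_pos (by positivity)).le]
  exact (mul_le_mul_of_nonneg_left (inv_Gamma_le hs hL) (by positivity)).trans
    (pow_mul_div_rpow_le hβ (norm_nonneg z) hz hL hRL k)

theorem continuous_mittagLeffler {β : ℝ} (hβ : 0 < β) : Continuous (mittagLeffler β) := by
  refine continuous_iff_continuousAt.2 fun z => ?_
  obtain ⟨L, hL, hRL⟩ := exists_rpow_ge hβ (‖z‖ + 1)
  have h : ContinuousOn (mittagLeffler β) (Metric.ball 0 (‖z‖ + 1)) := by
    refine continuousOn_tsum (fun k => by fun_prop)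
      (summable_one_add_mul_pow_mul_pow β L (q := 1 / 2) (by norm_num) (by norm_num)) ?_
    intro k w hw
    exact norm_mittagLeffler_term_le hβ (mem_ball_zero_iff.1 hw).le hL hRL k
  exact h.continuousAt (Metric.isOpen_ball.mem_nhds (by simp))

/-! ### Generating series and their identities -/

/-- The binomial series `(1 - X) ^ (-a)`. -/
noncomputable def risingSeries (𝕜 : Type*) [RCLike 𝕜] (a : ℝ) : PowerSeries 𝕜 :=
  PowerSeries.mk fun n => ((risingCoeff a n : ℝ) : 𝕜)

/-- The series `(ε + (1 - X) ^ β)⁻¹`. -/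
noncomputable def resolventSeries (𝕜 : Type*) [RCLike 𝕜] (β : ℝ) (ε : 𝕜) : PowerSeries 𝕜 :=
  (C ε + risingSeries 𝕜 (-β))⁻¹

/-- The generating series `(1 - X) ^ (β - 1) / (ε + (1 - X) ^ β)` of the discrete Mittag-Leffler
functions. -/
noncomputable def discreteMLSeries (𝕜 : Type*) [RCLike 𝕜] (β : ℝ) (ε : 𝕜) : PowerSeries 𝕜 :=
  risingSeries 𝕜 (1 - β) * resolventSeries 𝕜 β ε

section Series

variable {𝕜 : Type*} [RCLike 𝕜]

@[simp] theorem coeff_risingSeries (a : ℝ) (n : ℕ) :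
    coeff n (risingSeries 𝕜 a) = ((risingCoeff a n : ℝ) : 𝕜) := coeff_mk _ _

@[simp] theorem constantCoeff_risingSeries (a : ℝ) : constantCoeff (risingSeries 𝕜 a) = 1 := by
  rw [← coeff_zero_eq_constantCoeff_apply]; simp

theorem risingSeries_add (a b : ℝ) :
    risingSeries 𝕜 (a + b) = risingSeries 𝕜 a * risingSeries 𝕜 b := by
  ext n
  rw [coeff_mul]
  simp only [coeff_risingSeries, risingCoeff_add a b n]
  push_cast
  rfl

theorem risingSeries_zero : risingSeries 𝕜 0 = 1 := by
  ext n
  rcases n with _ | n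
  · simp
  · simp [risingCoeff_zero_left_succ, coeff_one]

theorem risingSeries_one_coeff (n : ℕ) : coeff n (risingSeries 𝕜 1) = 1 := by
  simp [risingCoeff_one]

theorem risingSeries_neg_mul (a : ℝ) : risingSeries 𝕜 (-a) * risingSeries 𝕜 a = 1 := by
  rw [← risingSeries_add, neg_add_cancel, risingSeries_zero]

theorem add_one_ne_zero_of_re_pos {ε : 𝕜} (hε : 0 < RCLike.re ε) : ε + 1 ≠ 0 := fun h => by
  have := congrArg RCLike.re h
  simp at this
  linarith

theorem resolventSeries_spec (β : ℝ) {ε : 𝕜} (hε : 0 < RCLike.re ε) :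
    (C ε + risingSeries 𝕜 (-β)) * resolventSeries 𝕜 β ε = 1 :=
  PowerSeries.mul_inv_cancel _ (by simpa using add_one_ne_zero_of_re_pos hε)

/-- A discrete form of the fractional integral equation for `E_β`: multiply the denominator by `(1 -
X)^(-β)`. -/
theorem discreteMLSeries_volterra (β : ℝ) {ε : 𝕜} (hε : 0 < RCLike.re ε) :
    (1 + C ε * risingSeries 𝕜 β) * discreteMLSeries 𝕜 β ε = risingSeries 𝕜 1 := by
  have h := resolventSeries_spec β hε
  have h1 : risingSeries 𝕜 1 = risingSeries 𝕜 β * risingSeries 𝕜 (1 - β) := by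
    rw [← risingSeries_add]; ring_nf
  have h2 := risingSeries_neg_mul (𝕜 := 𝕜) β
  rw [discreteMLSeries, h1]
  linear_combination (risingSeries 𝕜 β * risingSeries 𝕜 (1 - β)) * h -
    (risingSeries 𝕜 (1 - β) * resolventSeries 𝕜 β ε) * h2

theorem eq_discreteMLSeries (β : ℝ) {ε : 𝕜} (hε : 0 < RCLike.re ε) {D : PowerSeries 𝕜}
    (hD : (1 + C ε * risingSeries 𝕜 β) * D = risingSeries 𝕜 1) : D = discreteMLSeries 𝕜 β ε := by
  refine mul_left_cancel₀ (fun h => ?_) (hD.trans (discreteMLSeries_volterra β hε).symm)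
  have := congrArg constantCoeff h
  simp only [map_add, map_one, map_mul, constantCoeff_C, constantCoeff_risingSeries, mul_one,
    map_zero] at this
  exact add_one_ne_zero_of_re_pos hε (by rw [add_comm]; exact this)

/-- Multiplication by `(1 - X)⁻¹` takes partial sums, so the sign of the resolvent coefficients
controls monotonicity. -/
theorem discreteMLSeries_difference (β : ℝ) {ε : 𝕜} (hε : 0 < RCLike.re ε) :
    discreteMLSeries 𝕜 β ε = risingSeries 𝕜 1 * (1 - C ε * resolventSeries 𝕜 β ε) := by
  have h := resolventSeries_spec β hε
  have h1 : risingSeries 𝕜 (1 - β) = risingSeries 𝕜 1 * risingSeries 𝕜 (-β) := by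
    rw [← risingSeries_add]; ring_nf
  rw [discreteMLSeries, h1]
  linear_combination risingSeries 𝕜 1 * h

theorem resolventSeries_coeff_zero (β : ℝ) (ε : 𝕜) :
    coeff 0 (resolventSeries 𝕜 β ε) = (ε + 1)⁻¹ := by
  simp [resolventSeries]

theorem resolventSeries_coeff_succ (β : ℝ) {ε : 𝕜} (hε : 0 < RCLike.re ε) (n : ℕ) :
    coeff (n + 1) (resolventSeries 𝕜 β ε) = (ε + 1)⁻¹ *
      ∑ p ∈ Finset.HasAntidiagonal.antidiagonal n,
        ((-risingCoeff (-β) (p.1 + 1) : ℝ) : 𝕜) * coeff p.2 (resolventSeries 𝕜 β ε) := by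
  have h := congrArg (coeff (n + 1)) (resolventSeries_spec β hε)
  rw [add_mul, map_add, coeff_C_mul, coeff_mul, Finset.Nat.antidiagonal_succ, Finset.sum_cons,
    Finset.sum_map] at h
  simp only [coeff_risingSeries, risingCoeff_zero_right, Function.Embedding.prodMap,
    Function.Embedding.coeFn_mk, Prod.map_fst, Prod.map_snd, Function.Embedding.refl_apply,
    coeff_one, Nat.succ_ne_zero, if_false, Nat.succ_eq_add_one, RCLike.ofReal_one, one_mul] at h
  rw [eq_inv_mul_iff_mul_eq₀ (add_one_ne_zero_of_re_pos hε)]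
  simp only [RCLike.ofReal_neg, neg_mul, Finset.sum_neg_distrib]
  linear_combination h

end Series

/-! ### Positivity, domination and decay of the coefficients -/

theorem resolventSeries_coeff_nonneg {β : ℝ} (hβ0 : 0 ≤ β) (hβ1 : β ≤ 1) {t : ℝ} (ht : 0 < t)
    (n : ℕ) : 0 ≤ coeff n (resolventSeries ℝ β t) := by
  induction n using Nat.strong_induction_on with
  | _ n ih =>
    rcases n with _ | n
    · rw [resolventSeries_coeff_zero]; positivity
    · rw [resolventSeries_coeff_succ β (by simpa using ht)]
      refine mul_nonneg (by positivity) (Finset.sum_nonneg fun p hp => mul_nonneg ?_ (ih _ ?_))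
      · simpa using risingCoeff_neg_succ_nonpos hβ0 hβ1 p.1
      · have := Finset.HasAntidiagonal.mem_antidiagonal.1 hp
        omega

/-- Both sides obey the same recurrence with nonnegative weights, and `|ε + 1| ≥ Re ε + 1`. -/
theorem norm_resolventSeries_coeff_le {β : ℝ} (hβ0 : 0 ≤ β) (hβ1 : β ≤ 1) {ε : ℂ} (hε : 0 < ε.re)
    (n : ℕ) : ‖coeff n (resolventSeries ℂ β ε)‖ ≤ coeff n (resolventSeries ℝ β ε.re) := by
  have h1 : ‖(ε + 1)⁻¹‖ ≤ (ε.re + 1)⁻¹ := by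
    rw [norm_inv]
    refine inv_anti₀ (by positivity) ((Complex.re_le_norm (ε + 1)).trans' (by simp))
  induction n using Nat.strong_induction_on with
  | _ n ih =>
    rcases n with _ | n
    · simpa only [resolventSeries_coeff_zero] using h1
    · rw [resolventSeries_coeff_succ β (by simpa using hε),
        resolventSeries_coeff_succ β (by simpa using hε), norm_mul]
      refine mul_le_mul h1 ((norm_sum_le _ _).trans (Finset.sum_le_sum fun p hp => ?_))
        (norm_nonneg _) (by positivity)
      have hp' := Finset.HasAntidiagonal.mem_antidiagonal.1 hp
      have h2 := risingCoeff_neg_succ_nonpos hβ0 hβ1 p.1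
      rw [norm_mul, RCLike.norm_ofReal, abs_of_nonneg (by linarith)]
      exact mul_le_mul_of_nonneg_left (ih _ (by omega)) (by simpa using h2)

theorem norm_discreteMLSeries_coeff_le {β : ℝ} (hβ0 : 0 ≤ β) (hβ1 : β ≤ 1) {ε : ℂ} (hε : 0 < ε.re)
    (n : ℕ) : ‖coeff n (discreteMLSeries ℂ β ε)‖ ≤ coeff n (discreteMLSeries ℝ β ε.re) := by
  rw [discreteMLSeries, discreteMLSeries, coeff_mul, coeff_mul]
  refine (norm_sum_le _ _).trans (Finset.sum_le_sum fun p _ => ?_)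
  have h := risingCoeff_nonneg (sub_nonneg.2 hβ1) p.1
  rw [norm_mul, coeff_risingSeries, coeff_risingSeries, RCLike.norm_ofReal, abs_of_nonneg h]
  exact mul_le_mul_of_nonneg_left (norm_resolventSeries_coeff_le hβ0 hβ1 hε _) h

theorem discreteMLSeries_coeff_antitone {β : ℝ} (hβ0 : 0 ≤ β) (hβ1 : β ≤ 1) {t : ℝ} (ht : 0 < t) :
    Antitone fun n => coeff n (discreteMLSeries ℝ β t) := by
  have h : ∀ n, coeff n (discreteMLSeries ℝ β t) =
      ∑ p ∈ Finset.range (n + 1), coeff p (1 - C t * resolventSeries ℝ β t) := by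
    intro n
    rw [discreteMLSeries_difference β (by simpa using ht), mul_comm, coeff_mul,
      Finset.Nat.sum_antidiagonal_eq_sum_range_succ_mk]
    simp [risingCoeff_one]
  refine antitone_nat_of_succ_le fun n => ?_
  rw [h (n + 1), Finset.sum_range_succ, ← h]
  have := mul_nonneg ht.le (resolventSeries_coeff_nonneg hβ0 hβ1 ht (n + 1))
  simpa [coeff_one] using this

/-- By monotonicity every coefficient in the convolution equation may be replaced by the last one;
the weights sum to `risingCoeff (1 + β) n`. -/
theorem discreteMLSeries_coeff_le {β : ℝ} (hβ0 : 0 ≤ β) (hβ1 : β ≤ 1) {t : ℝ} (ht : 0 < t)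
    (n : ℕ) : coeff n (discreteMLSeries ℝ β t) ≤ (1 + t * risingCoeff (1 + β) n)⁻¹ := by
  have h := congrArg (coeff n) (discreteMLSeries_volterra (𝕜 := ℝ) β (by simpa using ht))
  rw [add_mul, one_mul, map_add, mul_assoc, coeff_C_mul, coeff_mul, risingSeries_one_coeff] at h
  have h1 : risingCoeff (1 + β) n =
      ∑ p ∈ Finset.HasAntidiagonal.antidiagonal n, risingCoeff β p.1 := by
    simp [add_comm 1 β, risingCoeff_add, risingCoeff_one]
  have h2 : risingCoeff (1 + β) n * coeff n (discreteMLSeries ℝ β t) ≤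
      ∑ p ∈ Finset.HasAntidiagonal.antidiagonal n,
        coeff p.1 (risingSeries ℝ β) * coeff p.2 (discreteMLSeries ℝ β t) := by
    rw [h1, Finset.sum_mul]
    refine Finset.sum_le_sum fun p hp => ?_
    rw [coeff_risingSeries]
    refine mul_le_mul_of_nonneg_left (discreteMLSeries_coeff_antitone hβ0 hβ1 ht ?_)
      (risingCoeff_nonneg hβ0 _)
    have := Finset.HasAntidiagonal.mem_antidiagonal.1 hp
    omega
  have h3 := risingCoeff_nonneg (show 0 ≤ 1 + β by linarith) n
  rw [← one_div, le_div_iff₀ (by positivity)]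
  linarith [mul_le_mul_of_nonneg_left h2 ht.le]

/-! ### Expansion of the coefficients in powers of `ε` -/

theorem summable_discreteML {β : ℝ} (hβ0 : 0 ≤ β) {ε : ℂ} (hε : ‖ε‖ < 1) (n : ℕ) :
    Summable fun k : ℕ => (-ε) ^ k * ((risingCoeff (1 + k * β) n : ℝ) : ℂ) := by
  refine Summable.of_norm_bounded (summable_one_add_mul_pow_mul_pow β n (norm_nonneg ε) hε) ?_
  intro k
  have hs : (0 : ℝ) ≤ k * β := by positivity
  rw [norm_mul, norm_pow, norm_neg, Complex.norm_real,
    Real.norm_of_nonneg (risingCoeff_nonneg (by positivity) n), mul_comm]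
  exact mul_le_mul_of_nonneg_right (risingCoeff_one_add_le hs n) (by positivity)

/-- Convolution with `risingCoeff β` raises `k` to `k + 1`, so the two sums telescope to the term `k
= 0`. -/
theorem tsum_discreteML_volterra {β : ℝ} (hβ0 : 0 ≤ β) {ε : ℂ} (hε : ‖ε‖ < 1) (n : ℕ) :
    ∑' k : ℕ, (-ε) ^ k * ((risingCoeff (1 + k * β) n : ℝ) : ℂ) +
      ε * ∑ p ∈ Finset.HasAntidiagonal.antidiagonal n, ((risingCoeff β p.1 : ℝ) : ℂ) *
        ∑' k : ℕ, (-ε) ^ k * ((risingCoeff (1 + k * β) p.2 : ℝ) : ℂ) = 1 := by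
  have hsum := summable_discreteML hβ0 hε
  have h1 : ∑ p ∈ Finset.HasAntidiagonal.antidiagonal n, ((risingCoeff β p.1 : ℝ) : ℂ) *
      ∑' k : ℕ, (-ε) ^ k * ((risingCoeff (1 + k * β) p.2 : ℝ) : ℂ) =
      ∑' k : ℕ, (-ε) ^ k * ((risingCoeff (1 + (k + 1 : ℕ) * β) n : ℝ) : ℂ) := by
    have h2 : ∀ k : ℕ, (-ε) ^ k * ((risingCoeff (1 + (k + 1 : ℕ) * β) n : ℝ) : ℂ) =
        ∑ p ∈ Finset.HasAntidiagonal.antidiagonal n, ((risingCoeff β p.1 : ℝ) : ℂ) *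
          ((-ε) ^ k * ((risingCoeff (1 + k * β) p.2 : ℝ) : ℂ)) := by
      intro k
      rw [show 1 + ((k + 1 : ℕ) : ℝ) * β = β + (1 + k * β) by push_cast; ring, risingCoeff_add,
        Complex.ofReal_sum, Finset.mul_sum]
      refine Finset.sum_congr rfl fun p _ => ?_
      rw [Complex.ofReal_mul]
      ring
    have h4 : ∀ p ∈ Finset.HasAntidiagonal.antidiagonal n, Summable fun k : ℕ =>
        ((risingCoeff β p.1 : ℝ) : ℂ) * ((-ε) ^ k * ((risingCoeff (1 + k * β) p.2 : ℝ) : ℂ)) :=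
      fun p _ => Summable.mul_left _ (hsum p.2)
    rw [tsum_congr h2, Summable.tsum_finsetSum h4]
    exact Finset.sum_congr rfl fun p _ => (tsum_mul_left).symm
  have h3 : ∑' k : ℕ, (-ε) ^ (k + 1) * ((risingCoeff (1 + (k + 1 : ℕ) * β) n : ℝ) : ℂ) =
      -ε * ∑' k : ℕ, (-ε) ^ k * ((risingCoeff (1 + (k + 1 : ℕ) * β) n : ℝ) : ℂ) := by
    rw [← tsum_mul_left]
    exact tsum_congr fun k => by ring
  rw [h1, (hsum n).tsum_eq_zero_add, h3]
  simp [risingCoeff_one]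

theorem discreteMLSeries_coeff_eq_tsum {β : ℝ} (hβ0 : 0 ≤ β) {ε : ℂ} (hε0 : 0 < ε.re)
    (hε : ‖ε‖ < 1) (n : ℕ) :
    coeff n (discreteMLSeries ℂ β ε) =
      ∑' k : ℕ, (-ε) ^ k * ((risingCoeff (1 + k * β) n : ℝ) : ℂ) := by
  suffices h : PowerSeries.mk (fun n => ∑' k : ℕ, (-ε) ^ k * ((risingCoeff (1 + k * β) n : ℝ) : ℂ))
      = discreteMLSeries ℂ β ε by rw [← h, coeff_mk]
  refine eq_discreteMLSeries β (by simpa using hε0) ?_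
  ext n
  rw [add_mul, one_mul, map_add, mul_assoc, coeff_C_mul, coeff_mul, risingSeries_one_coeff,
    coeff_mk]
  simp only [coeff_mk, coeff_risingSeries]
  exact tsum_discreteML_volterra hβ0 hε n

/-- The decay of the Mittag-Leffler function in the left half-plane. -/
theorem norm_mittagLeffler_neg_le {β : ℝ} (hβ0 : 0 < β) (hβ1 : β ≤ 1) {z : ℂ} (hz : 0 < z.re) :
    ‖mittagLeffler β (-z)‖ ≤ (1 + z.re * (Real.Gamma (β + 1))⁻¹)⁻¹ := by
  have hpow : Tendsto (fun n : ℕ => (n : ℝ) ^ β) atTop atTop :=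
    (tendsto_rpow_atTop hβ0).comp tendsto_natCast_atTop_atTop
  obtain ⟨L, hL, hRL⟩ := exists_rpow_ge hβ0 ‖z‖
  have hterm : ∀ k n : ℕ, (-(z / ((n : ℝ) ^ β : ℝ))) ^ k * ((risingCoeff (1 + k * β) n : ℝ) : ℂ) =
      (-z) ^ k * ((risingCoeff (1 + k * β) n / (n : ℝ) ^ (k * β) : ℝ) : ℂ) := by
    intro k n
    rw [mul_comm (k : ℝ) β, Real.rpow_mul_natCast (by positivity), ← neg_div, div_pow]
    push_cast
    ring
  have hlim : Tendsto (fun n : ℕ => ∑' k : ℕ, (-(z / ((n : ℝ) ^ β : ℝ))) ^ k *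
      ((risingCoeff (1 + k * β) n : ℝ) : ℂ)) atTop (𝓝 (mittagLeffler β (-z))) := by
    refine tendsto_tsum_of_dominated_convergence
      (summable_one_add_mul_pow_mul_pow β L (q := 1 / 2) (by norm_num) (by norm_num)) ?_ ?_
    · intro k
      simp only [hterm]
      rw [complex_Gamma_mul_add_one, div_eq_mul_inv, ← Complex.ofReal_inv]
      exact ((Complex.continuous_ofReal.tendsto _).comp
        (tendsto_risingCoeff_one_add_div_rpow (by positivity))).const_mul _
    · filter_upwards [eventually_ge_atTop L] with n hn k
      have hs : (0 : ℝ) ≤ k * β := by positivity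
      have hn' := risingCoeff_one_add_div_rpow_antitone hs hL hn
      rw [hterm, norm_mul, norm_pow, norm_neg, Complex.norm_real, Real.norm_of_nonneg
        (div_nonneg (risingCoeff_nonneg (by positivity) n) (by positivity))]
      refine (mul_le_mul_of_nonneg_left (hn'.trans ?_) (by positivity)).trans
        (pow_mul_div_rpow_le hβ0 (norm_nonneg z) le_rfl hL hRL k)
      gcongr
      exact risingCoeff_one_add_le hs L
  have hbound : Tendsto (fun n : ℕ => (1 + z.re * (risingCoeff (1 + β) n / (n : ℝ) ^ β))⁻¹) atTop
      (𝓝 (1 + z.re * (Real.Gamma (β + 1))⁻¹)⁻¹) := by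
    refine (((tendsto_risingCoeff_one_add_div_rpow hβ0.le).const_mul _).const_add _).inv₀ ?_
    have := Real.Gamma_pos_of_pos (show 0 < β + 1 by linarith)
    positivity
  refine le_of_tendsto_of_tendsto hlim.norm hbound ?_
  -- Large `n` puts `ε = z / n^β` in the unit disc, where the expansion in `ε` converges.
  filter_upwards [eventually_gt_atTop 0, hpow.eventually_gt_atTop ‖z‖] with n hn hzn
  have hp : (0 : ℝ) < (n : ℝ) ^ β := by positivity
  have hre : (z / ((n : ℝ) ^ β : ℝ)).re = z.re / (n : ℝ) ^ β := Complex.div_ofReal_re _ _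
  have hre0 : 0 < (z / ((n : ℝ) ^ β : ℝ)).re := by rw [hre]; positivity
  rw [← discreteMLSeries_coeff_eq_tsum hβ0.le hre0 ?_ n]
  · refine ((norm_discreteMLSeries_coeff_le hβ0.le hβ1 hre0 n).trans
      (discreteMLSeries_coeff_le hβ0.le hβ1 hre0 n)).trans_eq ?_
    rw [hre]
    ring_nf
  · rw [norm_div, Complex.norm_real, Real.norm_of_nonneg hp.le]
    exact (div_lt_one hp).2 hzn

/-! ### Bounds on the argument and integration -/

theorem norm_re_le_hnorm {E : Type*} [NormedAddCommGroup E] (f : Complexified E) :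
    ‖f.re‖ ≤ f.hnorm :=
  Real.le_sqrt_of_sq_le (by nlinarith [sq_nonneg ‖f.im‖])

theorem norm_im_le_hnorm {E : Type*} [NormedAddCommGroup E] (f : Complexified E) :
    ‖f.im‖ ≤ f.hnorm :=
  Real.le_sqrt_of_sq_le (by nlinarith [sq_nonneg ‖f.re‖])

section Donsker

variable {H : Type*} [NormedAddCommGroup H] [InnerProductSpace ℝ H]

theorem donskerArg_re (x : ℝ) (η : H) (f : Complexified H) :
    (donskerArg x η f).re = 1 / 2 * (x * ‖η‖) ^ 2 + 1 / 2 * (‖f.re‖ ^ 2 - ‖f.im‖ ^ 2) +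
      x * inner ℝ η f.re := by
  simp [donskerArg, Complexified.pairing, Complexified.ofReal, ← Complex.ofReal_pow]
  ring

theorem donskerArg_im (x : ℝ) (η : H) (f : Complexified H) :
    (donskerArg x η f).im = inner ℝ f.re f.im + x * inner ℝ η f.im := by
  simp [donskerArg, Complexified.pairing, Complexified.ofReal, ← Complex.ofReal_pow,
    real_inner_comm f.re f.im]
  ring

theorem continuous_donskerArg (η : H) (f : Complexified H) :
    Continuous fun x : ℝ => donskerArg x η f := by
  unfold donskerArg
  fun_prop

theorem abs_mul_inner_le (x : ℝ) (η : H) {g : H} {M : ℝ} (hg : ‖g‖ ≤ M) :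
    |x * inner ℝ η g| ≤ |x| * ‖η‖ * M := by
  rw [abs_mul, mul_assoc]
  refine mul_le_mul_of_nonneg_left ((abs_real_inner_le_norm η g).trans ?_) (abs_nonneg x)
  exact mul_le_mul_of_nonneg_left hg (norm_nonneg η)

/-- With `y = |x| ‖η‖`, the real part is at least `y²/2 - M²/2 - yM ≥ y²/4 - 3M²/2`; the last term
is absorbed by `y²/8` exactly when `y² ≥ 12 M²`. -/
theorem le_donskerArg_re {x : ℝ} {η : H} {f : Complexified H} {M : ℝ} (h1 : ‖f.re‖ ≤ M)
    (h2 : ‖f.im‖ ≤ M) (hx : 12 * M ^ 2 ≤ (x * ‖η‖) ^ 2) :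
    (x * ‖η‖) ^ 2 / 8 ≤ (donskerArg x η f).re := by
  have h3 := neg_le_of_abs_le (abs_mul_inner_le x η h1)
  have h4 : ‖f.im‖ ^ 2 ≤ M ^ 2 := pow_le_pow_left₀ (norm_nonneg _) h2 2
  have h5 : (x * ‖η‖) ^ 2 = (|x| * ‖η‖) ^ 2 := by rw [mul_pow, mul_pow, sq_abs]
  rw [donskerArg_re]
  nlinarith [sq_nonneg (|x| * ‖η‖ / 2 - M), sq_nonneg ‖f.re‖]

theorem norm_donskerArg_le {x : ℝ} {η : H} {f : Complexified H} {M : ℝ} (h1 : ‖f.re‖ ≤ M)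
    (h2 : ‖f.im‖ ≤ M) (hx : (x * ‖η‖) ^ 2 ≤ 12 * M ^ 2) : ‖donskerArg x η f‖ ≤ 18 * M ^ 2 := by
  have hM : 0 ≤ M := (norm_nonneg _).trans h1
  have h5 : (x * ‖η‖) ^ 2 = (|x| * ‖η‖) ^ 2 := by rw [mul_pow, mul_pow, sq_abs]
  have hxM : |x| * ‖η‖ ≤ 4 * M :=
    le_of_not_gt fun h => by nlinarith [pow_pos (h.trans_le' (by positivity : 0 ≤ 4 * M)) 2]
  have h3 := abs_le.1 (abs_mul_inner_le x η h1)
  have h4 := abs_le.1 (abs_mul_inner_le x η h2)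
  have h6 : ‖f.im‖ ^ 2 ≤ M ^ 2 := pow_le_pow_left₀ (norm_nonneg _) h2 2
  have h7 : ‖f.re‖ ^ 2 ≤ M ^ 2 := pow_le_pow_left₀ (norm_nonneg _) h1 2
  have h8 : |x| * ‖η‖ * M ≤ 4 * M ^ 2 := by nlinarith
  have h9 := abs_le.1 ((abs_real_inner_le_norm f.re f.im).trans
    (mul_le_mul h1 h2 (norm_nonneg _) hM))
  have hre : |(donskerArg x η f).re| ≤ 11 * M ^ 2 := by
    rw [donskerArg_re, abs_le]
    constructor <;> nlinarith [sq_nonneg ‖f.re‖, sq_nonneg ‖f.im‖, sq_nonneg (x * ‖η‖)]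
  have him : |(donskerArg x η f).im| ≤ 5 * M ^ 2 := by
    rw [donskerArg_im, abs_le]
    constructor <;> nlinarith
  exact (Complex.norm_le_abs_re_add_abs_im _).trans (by nlinarith)

theorem exists_integrable_bound_mittagLeffler_donskerArg {β : ℝ} (hβ0 : 0 < β) (hβ1 : β ≤ 1)
    {η : H} (hη : η ≠ 0) {M : ℝ} (hM : 0 < M) :
    ∃ b : ℝ → ℝ, Integrable b ∧ ∀ f : Complexified H, f.hnorm < M → ∀ x : ℝ,
      ‖mittagLeffler β (-donskerArg x η f)‖ ≤ b x := by
  obtain ⟨B, hB⟩ := (isCompact_closedBall (0 : ℂ) (18 * M ^ 2)).exists_bound_of_continuousOn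
    (continuous_mittagLeffler hβ0).continuousOn
  have hB0 : 0 ≤ B := (norm_nonneg _).trans (hB 0 (by simp; positivity))
  have hη' : 0 < ‖η‖ := norm_pos_iff.2 hη
  set g : ℝ := (Real.Gamma (β + 1))⁻¹ with hg_def
  have hg : 0 < g := inv_pos.2 (Real.Gamma_pos_of_pos (by linarith))
  -- The sum of the constants of the two ranges: `1` where the decay applies, the other term where
  -- `(x * ‖η‖) ^ 2 ≤ 12 * M ^ 2`.
  set A : ℝ := 1 + B * (1 + 12 * M ^ 2 / 8 * g) with hA
  have hc : 0 < g * ‖η‖ ^ 2 / 8 := by positivity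
  refine ⟨fun x => A * (1 + (Real.sqrt (g * ‖η‖ ^ 2 / 8) * x) ^ 2)⁻¹, ?_, ?_⟩
  · exact (integrable_inv_one_add_sq.comp_mul_left' (Real.sqrt_pos.2 hc).ne').const_mul A
  intro f hf x
  have h1 := (norm_re_le_hnorm f).trans hf.le
  have h2 := (norm_im_le_hnorm f).trans hf.le
  have hden : (Real.sqrt (g * ‖η‖ ^ 2 / 8) * x) ^ 2 = (x * ‖η‖) ^ 2 / 8 * g := by
    rw [mul_pow, Real.sq_sqrt hc.le]
    ring
  have hpos : 0 < 1 + (x * ‖η‖) ^ 2 / 8 * g := by positivity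
  simp only [hden]
  rw [← div_eq_mul_inv, le_div_iff₀ hpos]
  rcases le_total (12 * M ^ 2) ((x * ‖η‖) ^ 2) with hx | hx
  · have hre := le_donskerArg_re h1 h2 hx
    have hx0 : 0 < (x * ‖η‖) ^ 2 / 8 := by nlinarith [pow_pos hM 2]
    have h := norm_mittagLeffler_neg_le hβ0 hβ1 (hx0.trans_le hre)
    have h' : ‖mittagLeffler β (-donskerArg x η f)‖ ≤ (1 + (x * ‖η‖) ^ 2 / 8 * g)⁻¹ :=
      h.trans (inv_anti₀ hpos (by gcongr))
    calc _ ≤ (1 + (x * ‖η‖) ^ 2 / 8 * g)⁻¹ * (1 + (x * ‖η‖) ^ 2 / 8 * g) := by gcongr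
      _ = 1 := inv_mul_cancel₀ hpos.ne'
      _ ≤ A := by rw [hA]; linarith [show 0 ≤ B * (1 + 12 * M ^ 2 / 8 * g) by positivity]
  · have h := hB (-donskerArg x η f) (by
      rw [mem_closedBall_zero_iff, norm_neg]
      exact norm_donskerArg_le h1 h2 hx)
    calc _ ≤ B * (1 + 12 * M ^ 2 / 8 * g) := by gcongr
      _ ≤ A := by rw [hA]; linarith

end Donsker

theorem mainTheorem11 {N H : Type*} {K : ℕ → Type*}
    [AddCommGroup N] [Module ℝ N] [TopologicalSpace N]
    [NormedAddCommGroup H] [InnerProductSpace ℝ H] [CompleteSpace H]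
    [TopologicalSpace.SeparableSpace H]
    [∀ p, NormedAddCommGroup (K p)] [∀ p, InnerProductSpace ℝ (K p)] [∀ p, CompleteSpace (K p)]
    [∀ p, TopologicalSpace.SeparableSpace (K p)]
    (T : NuclearTriple N H K) (β : ℝ) (hβ0 : 0 < β) (hβ1 : β ≤ 1)
    (η : H) (hη : η ≠ 0) (M : ℝ) (hM : 0 < M) :
    ∃ C : ℝ, ∀ φ : Complexified N, (Complexified.map T.toH φ).hnorm < M →
      Integrable (fun x : ℝ => ‖mittagLeffler β (-donskerArg x η (Complexified.map T.toH φ))‖) ∧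
      ∫ x : ℝ, ‖mittagLeffler β (-donskerArg x η (Complexified.map T.toH φ))‖ ≤ C := by
  obtain ⟨b, hb, hle⟩ := exists_integrable_bound_mittagLeffler_donskerArg hβ0 hβ1 hη hM
  refine ⟨∫ x, b x, fun φ hφ => ?_⟩
  have hint : Integrable
      (fun x : ℝ => ‖mittagLeffler β (-donskerArg x η (Complexified.map T.toH φ))‖) :=
    hb.mono' ((continuous_mittagLeffler hβ0).comp
      (continuous_donskerArg η _).neg).norm.aestronglyMeasurable
      (Eventually.of_forall fun x => by simpa using hle _ hφ x)
  exact ⟨hint, integral_mono hint hb (hle _ hφ)⟩
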